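/- Let $\mathbb{D}=\{z\in\mathbb{C}:|z|<1\}$ and let $dA=\pi^{-1}\,dx\,dy$ be the normalized Lebesgue area measure on $\mathbb{D}$. For $0<p<\infty$ and $\alpha>-1$, let $A^p_\alpha$ be the weighted Bergman space of all analytic functions $f$ in $\mathbb{D}$ with $$ \|f\|_{p,\alpha}=\left(\int_{\mathbb{D}}|f(z)|^p\,(\alpha+1)(1-|z|^2)^\alpha\,dA(z)\right)^{1/p}<\infty . $$ Let $0<p<\infty$, $\alpha>-1$, $a\in\mathbb{D}$, and let $N$ be a positive integer. If $f\in A^p_\alpha$ and $f(a)=f'(a)=\dots=f^{(N-1)}(a)=0$, then $$ \left|f^{(N)}(a)\right|\le N!\left(\frac{\Gamma\left(\frac{Np}{2}+2+\alpha\right)}{\Gamma(2+\alpha)\,\Gamma\left(\frac{Np}{2}+1\right)}\right)^{1/p}\frac{\|f\|_{p,\alpha}}{(1-|a|^2)^{N+(2+\alpha)/p}} . $$ The inequality is sharp: for all such $p$, $\alpha$, $a$ and $N$, there is an $f\in A^p_\alpha$ with $f(a)=f'(a)=\dots=f^{(N-1)}(a)=0$ and $\|f\|_{p,\alpha}=1$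 for which equality holds. -/

import Mathlib

open MeasureTheory

noncomputable section

/-- The open unit disk in the complex plane. -/
def unitDisk : Set ℂ := Metric.ball 0 1

/-- The normalized Lebesgue area measure on the unit disk, `dA = π⁻¹ dx dy`. -/
def diskArea : Measure ℂ := ENNReal.ofReal (Real.pi⁻¹) • volume.restrict unitDisk

/-- The standard radial weight `(α + 1) (1 - |z|²) ^ α`. -/
def standardWeight (α : ℝ) (z : ℂ) : ℝ := (α + 1) * (1 - ‖z‖ ^ 2) ^ α

/-- The standard weighted Bergman space: the functions that are analytic in the unit disk and
`p`-integrable there with respect to the standard weight. Values outside the disk are irrelevant. -/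
def BergmanSpace (p α : ℝ) : Set (ℂ → ℂ) :=
  {f | AnalyticOnNhd ℂ f unitDisk ∧
    Integrable (fun z => ‖f z‖ ^ p * standardWeight α z) diskArea}

/-- The Bergman (quasi-)norm `(∫ |f|^p (α + 1) (1 - |z|²) ^ α dA) ^ (1 / p)`. -/
def bergmanNorm (p α : ℝ) (f : ℂ → ℂ) : ℝ :=
  (∫ z, ‖f z‖ ^ p * standardWeight α z ∂diskArea) ^ (1 / p)

/-- The functions in the Bergman space with `f(a) = f'(a) = ... = f^(N-1)(a) = 0`. -/
def BergmanVanishing (p α : ℝ) (N : ℕ) (a : ℂ) : Set (ℂ → ℂ) :=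
  {f | f ∈ BergmanSpace p α ∧ ∀ k < N, iteratedDeriv k f a = 0}

end

open ComplexConjugate

/-! For `a = 0`, write `f = z ^ N * H`. Since `‖H‖ ^ p` is subharmonic, its mean against the radial
weight `‖z‖ ^ (N * p) * (1 - ‖z‖ ^ 2) ^ α` is at least `‖H 0‖ ^ p` (`rpow_norm_mul_lintegral_le`).
The total mass of that weight is a Beta integral (`lintegral_radial_eq_beta`), which yields the
Gamma quotient. Equality holds when `H` is constant.

A general `a` reduces to `0` through the involution `φ` exchanging `0` and `a`: composing with `φ`
and multiplying by `isometryFactor` preserves the norm (`lintegral_isometry`) and moves the zero of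
order `N` from `a` to `0`. The extremal function is the image of a normalized monomial. -/

/-! ### Sub-mean value property of `‖g‖ ^ p` -/

/-- Jensen's formula gives the sub-mean value property of `log ‖g‖`; convexity of `exp` transfers it
to `‖g‖ ^ p` for every `p > 0`. -/
theorem rpow_norm_le_circleAverage {p : ℝ} (hp : 0 < p) {g : ℂ → ℂ} {R : ℝ} (hR : 0 < R)
    (hg : AnalyticOnNhd ℂ g (Metric.closedBall 0 R)) :
    ‖g 0‖ ^ p ≤ Real.circleAverage (fun z => ‖g z‖ ^ p) 0 R := by
  have habs : |R| = R := abs_of_pos hR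
  have hcont : ContinuousOn (fun z => ‖g z‖ ^ p) (Metric.sphere 0 |R|) := by
    rw [habs]
    exact ((hg.mono Metric.sphere_subset_closedBall).continuousOn.norm).rpow_const
      fun _ _ => Or.inr hp.le
  have hint : CircleIntegrable (fun z => ‖g z‖ ^ p) 0 R := by
    refine ContinuousOn.circleIntegrable' hcont
  by_cases h0 : g 0 = 0
  · rw [h0, norm_zero, Real.zero_rpow hp.ne']
    exact Real.circleAverage_nonneg_of_nonneg fun z _ => by positivity
  have hlog : CircleIntegrable (fun z => Real.log ‖g z‖) 0 R :=
    MeromorphicOn.circleIntegrable_log_norm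
      (by rw [habs]; exact (hg.mono Metric.sphere_subset_closedBall).meromorphicOn)
  have hjen : Real.log ‖g 0‖ ≤ Real.circleAverage (fun z => Real.log ‖g z‖) 0 R := by
    rw [AnalyticOnNhd.circleAverage_log_norm hR.ne' (by rwa [habs]) h0]
    refine le_add_of_nonneg_left (finsum_nonneg fun u => ?_)
    by_cases hu : u ∈ Metric.closedBall (0:ℂ) |R|
    · refine mul_nonneg ?_ ?_
      · have := (MeromorphicOn.AnalyticOnNhd.divisor_nonneg (by rwa [habs]) : 0 ≤ MeromorphicOn.divisor g (Metric.closedBall 0 |R|)) u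
        exact_mod_cast this
      -- At the centre the logarithm is `log (R * 0⁻¹) = log 0 = 0` by convention.
      · by_cases hu0 : u = 0
        · simp [hu0]
        · apply Real.log_nonneg
          rw [habs] at hu
          have : 0 < ‖u‖ := norm_pos_iff.mpr hu0
          simp only [Metric.mem_closedBall, dist_zero_right] at hu
          rw [zero_sub, norm_neg, ← div_eq_mul_inv, one_le_div this]
          exact hu
    · simp [hu]
  -- The two sides differ at zeros of `g`, where `log 0 = 0` by convention, so they agree only off a
  -- discrete set.
  have hcod : (fun z => Real.exp (p * (Real.log ‖g z‖ - Real.log ‖g 0‖)))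
      =ᶠ[Filter.codiscreteWithin (Metric.sphere 0 |R|)] fun z => ‖g z‖ ^ p / ‖g 0‖ ^ p := by
    have := hg.preimage_zero_mem_codiscreteWithin (x := 0) h0 (by simp [hR.le])
      ((convex_closedBall _ _).isConnected (by simp [hR.le]))
    have := Filter.codiscreteWithin_mono (Metric.sphere_subset_closedBall (x := (0:ℂ))) this
    rw [habs]
    filter_upwards [this] with z hz
    have hz : g z ≠ 0 := by simpa using hz
    have h1 := norm_pos_iff.mpr hz
    have h2 := norm_pos_iff.mpr h0
    rw [← Real.log_div h1.ne' h2.ne', mul_comm, ← Real.rpow_def_of_pos (by positivity),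
      Real.div_rpow h1.le h2.le]
  have hpos : 0 < ‖g 0‖ ^ p := Real.rpow_pos_of_pos (norm_pos_iff.mpr h0) _
  have hI : CircleIntegrable (fun z => Real.exp (p * (Real.log ‖g z‖ - Real.log ‖g 0‖))) 0 R :=
    CircleIntegrable.congr_codiscreteWithin hcod.symm
      (IntervalIntegrable.div_const hint _)
  have hl2 : CircleIntegrable (fun z => p • Real.log ‖g z‖ + (1 - p * Real.log ‖g 0‖)) 0 R :=
    (hlog.const_smul).add (circleIntegrable_const _ _ _)
  -- Jensen's inequality by hand: average the tangent line bound `x + 1 ≤ exp x` at `x = p * (log ‖g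
  -- z‖ - log ‖g 0‖)`.
  have hm := Real.circleAverage_mono hl2 hI (fun z _ => by
    have := Real.add_one_le_exp (p * (Real.log ‖g z‖ - Real.log ‖g 0‖))
    simp only [smul_eq_mul]
    linarith)
  rw [Real.circleAverage_congr_codiscreteWithin hcod hR.ne',
    Real.circleAverage_fun_add (f₁ := fun z => p • Real.log ‖g z‖) hlog.const_smul
      (circleIntegrable_const _ _ _),
    Real.circleAverage_const, Real.circleAverage_fun_smul] at hm
  have e : (fun z => ‖g z‖ ^ p / ‖g 0‖ ^ p) = fun z => (‖g 0‖ ^ p)⁻¹ • ‖g z‖ ^ p := by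
    ext z; rw [smul_eq_mul, div_eq_inv_mul]
  rw [e, Real.circleAverage_fun_smul, smul_eq_mul, smul_eq_mul, ← div_eq_inv_mul, le_div_iff₀ hpos] at hm
  refine le_trans ?_ hm
  refine le_mul_of_one_le_left hpos.le ?_
  nlinarith

theorem ofReal_rpow_norm_le_lintegral_circleMap {p : ℝ} (hp : 0 < p) {g : ℂ → ℂ} {R : ℝ}
    (hR : 0 < R) (hg : AnalyticOnNhd ℂ g (Metric.closedBall 0 R)) :
    ENNReal.ofReal (2 * Real.pi) * ENNReal.ofReal (‖g 0‖ ^ p) ≤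
      ∫⁻ θ in Set.Ioo (-Real.pi) Real.pi, ENNReal.ofReal (‖g (circleMap 0 R θ)‖ ^ p) := by
  have hcont : Continuous fun θ => ‖g (circleMap 0 R θ)‖ ^ p := by
    refine Continuous.rpow_const ?_ fun _ => Or.inr hp.le
    exact (hg.continuousOn.comp_continuous (continuous_circleMap 0 R)
      fun θ => circleMap_mem_closedBall 0 hR.le θ).norm
  have h := rpow_norm_le_circleAverage hp hR hg
  rw [Real.circleAverage_eq_integral_add (-Real.pi),
    intervalIntegral.integral_comp_add_right (fun θ => ‖g (circleMap 0 R θ)‖ ^ p) (-Real.pi),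
    smul_eq_mul, ← div_eq_inv_mul, le_div_iff₀ Real.two_pi_pos, zero_add,
    show 2 * Real.pi + -Real.pi = Real.pi by ring,
    intervalIntegral.integral_of_le (by linarith [Real.pi_pos]),
    integral_Ioc_eq_integral_Ioo] at h
  rw [← ENNReal.ofReal_mul Real.two_pi_pos.le, ← ofReal_integral_eq_lintegral_ofReal]
  · exact ENNReal.ofReal_le_ofReal (by linarith)
  · exact (hcont.integrableOn_Icc).mono_set Set.Ioo_subset_Icc_self
  · exact Filter.Eventually.of_forall fun θ => by positivity

theorem lintegral_unitDisk_polar {F : ℂ → ENNReal} (hF : Measurable F) :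
    ∫⁻ z in unitDisk, F z = ∫⁻ r in Set.Ioo (0 : ℝ) 1, ENNReal.ofReal r *
      ∫⁻ θ in Set.Ioo (-Real.pi) Real.pi, F (circleMap 0 r θ) := by
  have hm : MeasurableSet unitDisk := Metric.isOpen_ball.measurableSet
  rw [← lintegral_indicator hm, ← Complex.lintegral_comp_polarCoord_symm,
    polarCoord_target, Measure.volume_eq_prod, ← Measure.prod_restrict, lintegral_prod]
  · rw [show Set.Ioo (0 : ℝ) 1 = Set.Iio 1 ∩ Set.Ioi 0 from Set.Iio_inter_Ioi.symm,
      ← Measure.restrict_restrict measurableSet_Iio, ← lintegral_indicator measurableSet_Iio]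
    refine setLIntegral_congr_fun measurableSet_Ioi fun r hr => ?_
    have hr : 0 < r := hr
    have key : ∀ θ, Complex.polarCoord.symm (r, θ) = circleMap 0 r θ := fun θ => by
      rw [Complex.polarCoord_symm_apply, circleMap_zero, Complex.exp_mul_I]
      simp
    simp only [key, smul_eq_mul]
    by_cases h1 : r < 1
    · rw [Set.indicator_of_mem (by exact h1), ← lintegral_const_mul]
      · congr 1
        ext θ
        rw [Set.indicator_of_mem]
        simp [unitDisk, abs_of_pos hr, h1]
      · exact hF.comp (continuous_circleMap 0 r).measurable
    · rw [Set.indicator_of_notMem (by exact h1)]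
      refine (lintegral_congr fun θ => ?_).trans lintegral_zero
      rw [Set.indicator_of_notMem, mul_zero]
      simp [unitDisk, abs_of_pos hr, not_lt.mp h1]
  · refine Measurable.aemeasurable ?_
    refine (ENNReal.measurable_ofReal.comp measurable_fst).mul ?_
    refine (hF.indicator hm).comp ?_
    rw [show (Complex.polarCoord.symm : ℝ × ℝ → ℂ) =
        fun p => (p.1 : ℂ) * (Real.cos p.2 + Real.sin p.2 * Complex.I) from
      funext Complex.polarCoord_symm_apply]
    fun_prop

theorem rpow_norm_mul_lintegral_le {p : ℝ} (hp : 0 < p) {g : ℂ → ℂ}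
    (hg : AnalyticOnNhd ℂ g unitDisk) {ρ : ℝ → ENNReal} (hρ : Measurable ρ) :
    ENNReal.ofReal (‖g 0‖ ^ p) * ∫⁻ z in unitDisk, ρ ‖z‖ ≤
      ∫⁻ z in unitDisk, ρ ‖z‖ * ENNReal.ofReal (‖g z‖ ^ p) := by
  have hm : MeasurableSet unitDisk := Metric.isOpen_ball.measurableSet
  -- `g` is arbitrary off the disk, so it is cut off there to become measurable.
  have hgm : Measurable (unitDisk.indicator g) := by
    classical
    rw [← Set.piecewise_eq_indicator]
    exact hg.continuousOn.measurable_piecewise continuousOn_const hm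
  have h1 : ∫⁻ z in unitDisk, ρ ‖z‖ * ENNReal.ofReal (‖g z‖ ^ p) =
      ∫⁻ z in unitDisk, ρ ‖z‖ * ENNReal.ofReal (‖unitDisk.indicator g z‖ ^ p) :=
    setLIntegral_congr_fun hm fun z hz => by simp only [Set.indicator_of_mem hz]
  rw [h1, lintegral_unitDisk_polar (by fun_prop), lintegral_unitDisk_polar (by fun_prop),
    ← lintegral_const_mul _ (by fun_prop)]
  refine setLIntegral_mono' measurableSet_Ioo fun r hr => ?_
  have hball : Metric.closedBall (0:ℂ) r ⊆ unitDisk := Metric.closedBall_subset_ball hr.2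
  have h2 := ofReal_rpow_norm_le_lintegral_circleMap hp hr.1 (hg.mono hball)
  simp only [norm_circleMap_zero, abs_of_pos hr.1]
  rw [lintegral_const, lintegral_const_mul _ (by fun_prop), Measure.restrict_apply_univ,
    Real.volume_Ioo, sub_neg_eq_add, ← two_mul]
  have h3 : ∀ θ, unitDisk.indicator g (circleMap 0 r θ) = g (circleMap 0 r θ) := fun θ =>
    Set.indicator_of_mem (hball (circleMap_mem_closedBall 0 hr.1.le θ)) _
  simp only [h3]
  calc _ = ENNReal.ofReal r * (ρ r * (ENNReal.ofReal (2 * Real.pi) * ENNReal.ofReal (‖g 0‖ ^ p))) := by ring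
    _ ≤ _ := by gcongr

/-! ### Radial moments of the weight -/

/-- With `t = r ^ 2` the normalized area becomes `dt`, leaving `(α + 1) * B(s / 2 + 1, α + 1)`; the
total mass one of the Beta distribution evaluates it. -/
theorem lintegral_radial_eq_beta {s α : ℝ} (hs : 0 ≤ s) (hα : -1 < α) :
    ∫⁻ z, ENNReal.ofReal (‖z‖ ^ s * standardWeight α z) ∂diskArea =
      ENNReal.ofReal (Real.Gamma (2 + α) * Real.Gamma (s / 2 + 1) /
        Real.Gamma (s / 2 + 2 + α)) := by
  set G : ℝ → ENNReal := fun t => ENNReal.ofReal (t ^ (s / 2) * ((α + 1) * (1 - t) ^ α)) with hG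
  have hGm : Measurable G := by fun_prop
  have hα1 : 0 < α + 1 := by linarith
  have hs1 : 0 < s / 2 + 1 := by linarith
  have hb := ProbabilityTheory.beta_pos hs1 hα1
  have himage : (fun r : ℝ => r ^ 2) '' Set.Ioo 0 1 = Set.Ioo 0 1 := by
    ext t
    constructor
    · rintro ⟨r, hr, rfl⟩
      exact ⟨pow_pos hr.1 2, pow_lt_one₀ hr.1.le hr.2 two_ne_zero⟩
    · intro ht
      refine ⟨√t, ⟨Real.sqrt_pos.2 ht.1, ?_⟩, Real.sq_sqrt ht.1.le⟩
      rw [Real.sqrt_lt' one_pos]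
      simpa using ht.2
  calc ∫⁻ z, ENNReal.ofReal (‖z‖ ^ s * standardWeight α z) ∂diskArea
      = ENNReal.ofReal Real.pi⁻¹ * ∫⁻ z in unitDisk, G (‖z‖ ^ 2) := by
        rw [diskArea, lintegral_smul_measure, smul_eq_mul]
        congr 2
        ext z
        simp only [hG, standardWeight]
        rw [← Real.rpow_natCast_mul (norm_nonneg z)]
        congr 3
        push_cast
        ring
    _ = ENNReal.ofReal Real.pi⁻¹ * ∫⁻ r in Set.Ioo (0 : ℝ) 1, ENNReal.ofReal r *
          (G (r ^ 2) * ENNReal.ofReal (2 * Real.pi)) := by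
        rw [lintegral_unitDisk_polar (by fun_prop)]
        congr 1
        refine setLIntegral_congr_fun measurableSet_Ioo fun r hr => ?_
        simp only [norm_circleMap_zero, sq_abs]
        rw [lintegral_const, Measure.restrict_apply_univ, Real.volume_Ioo, sub_neg_eq_add,
          ← two_mul]
    _ = ∫⁻ r in Set.Ioo (0 : ℝ) 1, ENNReal.ofReal |2 * r| * G (r ^ 2) := by
        rw [← lintegral_const_mul _ (by fun_prop)]
        refine setLIntegral_congr_fun measurableSet_Ioo fun r hr => ?_
        have : ENNReal.ofReal |2 * r| =
            ENNReal.ofReal Real.pi⁻¹ * ENNReal.ofReal r * ENNReal.ofReal (2 * Real.pi) := by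
          rw [← ENNReal.ofReal_mul (by positivity),
            ← ENNReal.ofReal_mul (mul_nonneg (by positivity) hr.1.le),
            abs_of_pos (mul_pos two_pos hr.1)]
          congr 1
          field_simp
        simp only [this]
        ring
    _ = ∫⁻ t in Set.Ioo (0 : ℝ) 1, G t := by
        rw [← lintegral_image_eq_lintegral_abs_deriv_mul measurableSet_Ioo
          (f := fun r : ℝ => r ^ 2) (f' := fun r => 2 * r)
          (fun r _ => by simpa using (hasDerivAt_pow 2 r).hasDerivWithinAt)
          (fun x hx y hy h => (pow_left_inj₀ hx.1.le hy.1.le two_ne_zero).1 h), himage]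
    _ = ENNReal.ofReal ((α + 1) * ProbabilityTheory.beta (s / 2 + 1) (α + 1)) *
          ∫⁻ t, ProbabilityTheory.betaPDF (s / 2 + 1) (α + 1) t := by
        rw [ProbabilityTheory.lintegral_betaPDF, ← lintegral_const_mul _ (by fun_prop)]
        refine setLIntegral_congr_fun measurableSet_Ioo fun t ht => ?_
        simp only [hG]
        rw [← ENNReal.ofReal_mul (by positivity), add_sub_cancel_right, add_sub_cancel_right]
        congr 1
        generalize ProbabilityTheory.beta (s / 2 + 1) (α + 1) = b at hb
        field_simp
    _ = _ := by
        rw [ProbabilityTheory.lintegral_betaPDF_eq_one hs1 hα1, mul_one, ProbabilityTheory.beta,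
          show 2 + α = (α + 1) + 1 by ring, Real.Gamma_add_one hα1.ne',
          show s / 2 + 2 + α = s / 2 + 1 + (α + 1) by ring]
        congr 1
        ring

/-! ### The disk involution and the induced isometry -/

/-- The involutive automorphism of the unit disk that exchanges `0` and `a`. -/
noncomputable def diskInvolution (a z : ℂ) : ℂ := (a - z) / (1 - conj a * z)

/-- The factor that makes composition with `diskInvolution a` an isometry of the weighted Bergman
space: its `p`-th power has modulus `((1 - ‖a‖ ^ 2) / ‖1 - conj a * z‖ ^ 2) ^ (2 + α)`. -/
noncomputable def isometryFactor (p α : ℝ) (a z : ℂ) : ℂ :=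
  (((1 - ‖a‖ ^ 2) ^ ((2 + α) / p) : ℝ) : ℂ) * (1 - conj a * z) ^ ((-(2 * ((2 + α) / p)) : ℝ) : ℂ)

theorem mem_unitDisk {z : ℂ} : z ∈ unitDisk ↔ ‖z‖ < 1 := by simp [unitDisk]

theorem one_sub_norm_sq_pos {a : ℂ} (ha : a ∈ unitDisk) : 0 < 1 - ‖a‖ ^ 2 := by
  have := mem_unitDisk.1 ha
  nlinarith [norm_nonneg a]

/-- Keeps `1 - conj a * z` off the branch cut of the complex power in `isometryFactor`. -/
theorem one_sub_conj_mul_re_pos {a z : ℂ} (ha : a ∈ unitDisk) (hz : z ∈ unitDisk) :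
    0 < (1 - conj a * z).re := by
  have h1 := mem_unitDisk.1 ha
  have h2 := mem_unitDisk.1 hz
  have h3 : ‖conj a * z‖ < 1 := by
    rw [norm_mul, Complex.norm_conj]
    exact mul_lt_one_of_nonneg_of_lt_one_left (norm_nonneg a) h1 h2.le
  have := Complex.re_le_norm (conj a * z)
  rw [Complex.sub_re, Complex.one_re]
  linarith

theorem one_sub_conj_mul_ne_zero {a z : ℂ} (ha : a ∈ unitDisk) (hz : z ∈ unitDisk) :
    1 - conj a * z ≠ 0 := fun h => by
  simpa [h] using one_sub_conj_mul_re_pos ha hz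

theorem one_sub_norm_diskInvolution_sq {a z : ℂ} (ha : a ∈ unitDisk) (hz : z ∈ unitDisk) :
    1 - ‖diskInvolution a z‖ ^ 2 =
      (1 - ‖a‖ ^ 2) * (1 - ‖z‖ ^ 2) / ‖1 - conj a * z‖ ^ 2 := by
  have h := norm_ne_zero_iff.2 (one_sub_conj_mul_ne_zero ha hz)
  rw [diskInvolution, norm_div, div_pow, eq_div_iff (pow_ne_zero 2 h), sub_mul,
    div_mul_cancel₀ _ (pow_ne_zero 2 h)]
  simp only [← Complex.normSq_eq_norm_sq, Complex.normSq_apply, Complex.sub_re, Complex.sub_im,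
    Complex.mul_re, Complex.mul_im, Complex.conj_re, Complex.conj_im, Complex.one_re,
    Complex.one_im]
  ring

theorem diskInvolution_mem {a z : ℂ} (ha : a ∈ unitDisk) (hz : z ∈ unitDisk) :
    diskInvolution a z ∈ unitDisk := by
  have h := norm_pos_iff.2 (one_sub_conj_mul_ne_zero ha hz)
  have h1 : 0 < 1 - ‖diskInvolution a z‖ ^ 2 := by
    rw [one_sub_norm_diskInvolution_sq ha hz]
    have := one_sub_norm_sq_pos ha
    have := one_sub_norm_sq_pos hz
    positivity
  rw [mem_unitDisk]
  nlinarith [norm_nonneg (diskInvolution a z)]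

theorem ofReal_one_sub_norm_sq (a : ℂ) : ((1 - ‖a‖ ^ 2 : ℝ) : ℂ) = 1 - conj a * a := by
  rw [Complex.conj_mul']
  push_cast
  rfl

/-- The explicit factor `z` turns a zero at `a` into a zero at `0`. -/
theorem diskInvolution_sub {a z : ℂ} (ha : a ∈ unitDisk) (hz : z ∈ unitDisk) :
    diskInvolution a z - a = z * (-(1 - conj a * a) / (1 - conj a * z)) := by
  have h := one_sub_conj_mul_ne_zero ha hz
  rw [diskInvolution, ← mul_div_assoc, eq_div_iff h, sub_mul, div_mul_cancel₀ _ h]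
  ring

theorem one_sub_conj_mul_diskInvolution {a z : ℂ} (ha : a ∈ unitDisk) (hz : z ∈ unitDisk) :
    1 - conj a * diskInvolution a z = (1 - conj a * a) / (1 - conj a * z) := by
  have h := one_sub_conj_mul_ne_zero ha hz
  rw [eq_div_iff h, sub_mul, mul_assoc, diskInvolution, div_mul_cancel₀ _ h]
  ring

theorem diskInvolution_diskInvolution {a z : ℂ} (ha : a ∈ unitDisk) (hz : z ∈ unitDisk) :
    diskInvolution a (diskInvolution a z) = z := by
  have h := one_sub_conj_mul_ne_zero ha hz
  have h' := one_sub_conj_mul_ne_zero ha ha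
  rw [diskInvolution, one_sub_conj_mul_diskInvolution ha hz, ← neg_sub, diskInvolution_sub ha hz,
    div_eq_iff (div_ne_zero h' h)]
  ring

theorem diskInvolution_image {a : ℂ} (ha : a ∈ unitDisk) :
    diskInvolution a '' unitDisk = unitDisk :=
  Set.Subset.antisymm (Set.image_subset_iff.2 fun _ hz => diskInvolution_mem ha hz)
    fun _ hz => ⟨_, diskInvolution_mem ha hz, diskInvolution_diskInvolution ha hz⟩

theorem diskInvolution_injOn {a : ℂ} (ha : a ∈ unitDisk) :
    Set.InjOn (diskInvolution a) unitDisk := fun x hx y hy h => by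
  rw [← diskInvolution_diskInvolution ha hx, h, diskInvolution_diskInvolution ha hy]

theorem hasDerivAt_diskInvolution {a z : ℂ} (ha : a ∈ unitDisk) (hz : z ∈ unitDisk) :
    HasDerivAt (diskInvolution a) (-(1 - conj a * a) / (1 - conj a * z) ^ 2) z := by
  have h := one_sub_conj_mul_ne_zero ha hz
  have h1 : HasDerivAt (fun z => a - z) (-1) z := by simpa using (hasDerivAt_id z).const_sub a
  have h2 : HasDerivAt (fun z => 1 - conj a * z) (-(conj a)) z := by
    simpa using ((hasDerivAt_id z).const_mul (conj a)).const_sub 1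
  convert! h1.div h2 h using 1
  congr 1
  ring

/-- By the Cauchy-Riemann equations, the real Jacobian of a holomorphic map is `‖φ'‖ ^ 2`. -/
theorem lintegral_image_eq_lintegral_norm_deriv_sq_mul {s : Set ℂ} (hs : MeasurableSet s)
    {φ φ' : ℂ → ℂ} (hφ : ∀ z ∈ s, HasDerivAt φ (φ' z) z) (hinj : Set.InjOn φ s)
    (F : ℂ → ENNReal) :
    ∫⁻ z in φ '' s, F z = ∫⁻ z in s, ENNReal.ofReal (‖φ' z‖ ^ 2) * F (φ z) := by
  rw [lintegral_image_eq_lintegral_abs_det_fderiv_mul volume hs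
    (fun z hz => ((hφ z hz).hasFDerivAt.restrictScalars ℝ).hasFDerivWithinAt) hinj]
  refine setLIntegral_congr_fun hs fun z _ => ?_
  simp [ContinuousLinearMap.det, LinearMap.det_restrictScalars,
      Algebra.norm_complex_eq, Complex.normSq_eq_norm_sq]

theorem norm_isometryFactor_rpow {p : ℝ} (hp : 0 < p) (α : ℝ) {a z : ℂ} (ha : a ∈ unitDisk)
    (hz : z ∈ unitDisk) :
    ‖isometryFactor p α a z‖ ^ p = ((1 - ‖a‖ ^ 2) / ‖1 - conj a * z‖ ^ 2) ^ (2 + α) := by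
  have h := norm_pos_iff.2 (one_sub_conj_mul_ne_zero ha hz)
  have hc := one_sub_norm_sq_pos ha
  rw [isometryFactor, norm_mul, Complex.norm_cpow_real, Complex.norm_real, Real.norm_eq_abs,
    abs_of_pos (Real.rpow_pos_of_pos hc _), Real.mul_rpow (by positivity) (by positivity),
    ← Real.rpow_mul hc.le, ← Real.rpow_mul h.le, Real.div_rpow hc.le (by positivity),
    ← Real.rpow_natCast_mul h.le, div_eq_mul_inv (_ ^ (2 + α)), ← Real.rpow_neg h.le]
  congr 2
  · field_simp
  · push_cast
    field_simp

/-- Put `q = (1 - ‖a‖ ^ 2) / ‖1 - conj a * z‖ ^ 2`. The Jacobian contributes `q ^ 2` and the weight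
`q ^ α`; together they are the `p`-th power of the factor's modulus. -/
theorem lintegral_isometry {p : ℝ} (hp : 0 < p) (α : ℝ) {a : ℂ} (ha : a ∈ unitDisk) (f : ℂ → ℂ) :
    ∫⁻ z, ENNReal.ofReal
        (‖f (diskInvolution a z) * isometryFactor p α a z‖ ^ p * standardWeight α z) ∂diskArea =
      ∫⁻ z, ENNReal.ofReal (‖f z‖ ^ p * standardWeight α z) ∂diskArea := by
  have hm : MeasurableSet unitDisk := Metric.isOpen_ball.measurableSet
  rw [diskArea, lintegral_smul_measure, lintegral_smul_measure]
  congr 1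
  conv_rhs => rw [← diskInvolution_image ha]
  rw [lintegral_image_eq_lintegral_norm_deriv_sq_mul hm
    (fun z hz => hasDerivAt_diskInvolution ha hz) (diskInvolution_injOn ha)]
  refine setLIntegral_congr_fun hm fun z hz => ?_
  have h := norm_pos_iff.2 (one_sub_conj_mul_ne_zero ha hz)
  have hc := one_sub_norm_sq_pos ha
  have hz' := one_sub_norm_sq_pos hz
  rw [← ENNReal.ofReal_mul (by positivity), norm_mul, Real.mul_rpow (by positivity) (by positivity),
    norm_isometryFactor_rpow hp α ha hz, standardWeight, standardWeight,
    one_sub_norm_diskInvolution_sq ha hz, ← ofReal_one_sub_norm_sq, norm_div, norm_neg,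
    Complex.norm_real, Real.norm_eq_abs, abs_of_pos hc, norm_pow, mul_div_right_comm,
    Real.mul_rpow (by positivity) hz'.le, Real.rpow_add (by positivity)]
  congr 1
  rw [Real.rpow_two]
  ring

theorem analyticAt_isometryFactor (p α : ℝ) {a z : ℂ} (ha : a ∈ unitDisk) (hz : z ∈ unitDisk) :
    AnalyticAt ℂ (isometryFactor p α a) z := by
  unfold isometryFactor
  refine analyticAt_const.mul (AnalyticAt.cpow (by fun_prop) analyticAt_const ?_)
  exact Or.inl (one_sub_conj_mul_re_pos ha hz)

theorem analyticAt_diskInvolution {a z : ℂ} (ha : a ∈ unitDisk) (hz : z ∈ unitDisk) :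
    AnalyticAt ℂ (diskInvolution a) z :=
  AnalyticAt.div (by fun_prop) (by fun_prop) (one_sub_conj_mul_ne_zero ha hz)

/-! ### Zeros of order `N` -/

theorem iteratedDeriv_sub_pow_mul {g : ℂ → ℂ} {a : ℂ} (hg : AnalyticAt ℂ g a) (N : ℕ) :
    (∀ k < N, iteratedDeriv k (fun z => (z - a) ^ N * g z) a = 0) ∧
      iteratedDeriv N (fun z => (z - a) ^ N * g z) a = N.factorial * g a := by
  have hpow : ∀ i, iteratedDeriv i (fun z => (z - a) ^ N) a =
      if i = N then (N.factorial : ℂ) else 0 :=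
    fun i => by
      rw [iteratedDeriv_comp_sub_const i (fun z : ℂ => z ^ N) a]
      simp only [sub_self, iteratedDeriv_fun_pow_zero]
      push_cast
      rfl
  have hmul : ∀ k, iteratedDeriv k (fun z => (z - a) ^ N * g z) a =
      ∑ i ∈ Finset.range (k + 1), k.choose i * (if i = N then (N.factorial : ℂ) else 0) *
        iteratedDeriv (k - i) g a := fun k => by
    rw [iteratedDeriv_fun_mul (AnalyticAt.contDiffAt (by fun_prop)) hg.contDiffAt]
    simp only [hpow]
  refine ⟨fun k hk => ?_, ?_⟩
  · rw [hmul]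
    refine Finset.sum_eq_zero fun i hi => ?_
    have := Finset.mem_range.1 hi
    rw [if_neg (by omega), mul_zero, zero_mul]
  · rw [hmul, Finset.sum_eq_single N (fun i _ hi => by rw [if_neg hi, mul_zero, zero_mul])
      (fun h => absurd (Finset.self_mem_range_succ N) h)]
    simp

/-- The equality holds on all of `ℂ`, so `f` can be replaced by the product outright. -/
theorem exists_eq_sub_pow_mul {f : ℂ → ℂ} {U : Set ℂ} (hf : AnalyticOnNhd ℂ f U) {a : ℂ} {N : ℕ}
    (ha : a ∈ U) (h : ∀ k < N, iteratedDeriv k f a = 0) :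
    ∃ g, AnalyticOnNhd ℂ g U ∧ f = fun z => (z - a) ^ N * g z := by
  obtain ⟨g₀, hg₀, hfg⟩ := (natCast_le_analyticOrderAt (hf a ha)).1
    ((natCast_le_analyticOrderAt_iff_iteratedDeriv_eq_zero (hf a ha)).2 h)
  have hne : ∀ {z : ℂ}, z ≠ a → (z - a) ^ N ≠ 0 := fun hz => pow_ne_zero _ (sub_ne_zero.2 hz)
  -- The quotient has a removable singularity at `a`; the local cofactor `g₀` supplies the value
  -- there.
  refine ⟨Function.update (fun z => f z / (z - a) ^ N) a (g₀ a), fun z hz => ?_, ?_⟩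
  · by_cases hza : z = a
    · subst hza
      refine hg₀.congr (hfg.mono fun w hw => ?_)
      by_cases hwz : w = z
      · rw [hwz, Function.update_self]
      · rw [Function.update_of_ne hwz, hw, smul_eq_mul, mul_div_cancel_left₀ _ (hne hwz)]
    · refine ((hf z hz).div (g := fun z => (z - a) ^ N) (by fun_prop) (hne hza)).congr ?_
      filter_upwards [isOpen_ne.mem_nhds hza] with w hw
      rw [Function.update_of_ne hw]
      rfl
  · ext z
    by_cases hza : z = a
    · rw [hza, Function.update_self, hfg.self_of_nhds, smul_eq_mul]
    · rw [Function.update_of_ne hza, mul_div_cancel₀ _ (hne hza)]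

/-! ### The sharp lower bound for the norm -/

theorem standardWeight_nonneg {α : ℝ} (hα : -1 < α) {z : ℂ} (hz : z ∈ unitDisk) :
    0 ≤ standardWeight α z :=
  mul_nonneg (by linarith) (Real.rpow_nonneg (one_sub_norm_sq_pos hz).le _)

theorem ae_mem_unitDisk : ∀ᵐ z ∂diskArea, z ∈ unitDisk :=
  Measure.ae_smul_measure (ae_restrict_mem Metric.isOpen_ball.measurableSet) _

theorem ae_integrand_nonneg {α : ℝ} (hα : -1 < α) (p : ℝ) (f : ℂ → ℂ) :
    0 ≤ᵐ[diskArea] fun z => ‖f z‖ ^ p * standardWeight α z := by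
  filter_upwards [ae_mem_unitDisk] with z hz
  exact mul_nonneg (Real.rpow_nonneg (norm_nonneg _) _) (standardWeight_nonneg hα hz)

theorem aestronglyMeasurable_integrand {p : ℝ} (hp : 0 < p) (α : ℝ) {f : ℂ → ℂ}
    (hf : ContinuousOn f unitDisk) :
    AEStronglyMeasurable (fun z => ‖f z‖ ^ p * standardWeight α z) diskArea := by
  have h1 : AEStronglyMeasurable (fun z => ‖f z‖ ^ p) diskArea :=
    (((hf.norm.rpow_const fun _ _ => Or.inr hp.le)).aestronglyMeasurable
      Metric.isOpen_ball.measurableSet).smul_measure _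
  have h2 : Measurable (standardWeight α) := by
    unfold standardWeight
    fun_prop
  exact h1.mul h2.aestronglyMeasurable

theorem analyticAt_div_one_sub_conj_mul_pow (c : ℂ) (N : ℕ) {a z : ℂ} (ha : a ∈ unitDisk)
    (hz : z ∈ unitDisk) : AnalyticAt ℂ (fun z => (c / (1 - conj a * z)) ^ N) z := by
  have h : AnalyticAt ℂ (fun z => 1 - conj a * z) z := by fun_prop
  exact (analyticAt_const.fun_div h (one_sub_conj_mul_ne_zero ha hz)).fun_pow N

/-- The `p`-th power of the weighted Bergman norm of `z ^ N`. -/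
noncomputable def monomialNormPow (p α : ℝ) (N : ℕ) : ℝ :=
  Real.Gamma (2 + α) * Real.Gamma (N * p / 2 + 1) / Real.Gamma (N * p / 2 + 2 + α)

theorem monomialNormPow_pos {p α : ℝ} (hp : 0 < p) (hα : -1 < α) (N : ℕ) :
    0 < monomialNormPow p α N := by
  have h : 0 ≤ N * p / 2 := by positivity
  exact div_pos (mul_pos (Real.Gamma_pos_of_pos (by linarith))
    (Real.Gamma_pos_of_pos (by linarith))) (Real.Gamma_pos_of_pos (by linarith))

/-- The factor `‖z‖ ^ (N * p)` is radial, so it joins the weight and the sub-mean value property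
applies to `H` alone. -/
theorem monomialNormPow_mul_le {p α : ℝ} (hp : 0 < p) (hα : -1 < α) (N : ℕ) {H : ℂ → ℂ}
    (hH : AnalyticOnNhd ℂ H unitDisk) :
    ENNReal.ofReal (‖H 0‖ ^ p * monomialNormPow p α N) ≤
      ∫⁻ z, ENNReal.ofReal (‖z ^ N * H z‖ ^ p * standardWeight α z) ∂diskArea := by
  have hs : 0 ≤ N * p := by positivity
  have hm : MeasurableSet unitDisk := Metric.isOpen_ball.measurableSet
  rw [ENNReal.ofReal_mul (by positivity), monomialNormPow, ← lintegral_radial_eq_beta hs hα,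
    diskArea, lintegral_smul_measure, lintegral_smul_measure, smul_eq_mul, smul_eq_mul,
    mul_left_comm]
  gcongr
  have h := rpow_norm_mul_lintegral_le hp hH
    (ρ := fun r => ENNReal.ofReal (r ^ (N * p) * ((α + 1) * (1 - r ^ 2) ^ α))) (by fun_prop)
  refine h.trans_eq (setLIntegral_congr_fun hm fun z hz => ?_)
  have := one_sub_norm_sq_pos hz
  have hα' : 0 < α + 1 := by linarith
  simp only [standardWeight]
  rw [← ENNReal.ofReal_mul (by positivity), norm_mul, norm_pow,
    Real.mul_rpow (by positivity) (by positivity), ← Real.rpow_natCast_mul (norm_nonneg z)]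
  congr 1
  ring

theorem lintegral_monomial {p α : ℝ} (hp : 0 < p) (hα : -1 < α) (N : ℕ) :
    ∫⁻ z, ENNReal.ofReal (‖z ^ N‖ ^ p * standardWeight α z) ∂diskArea =
      ENNReal.ofReal (monomialNormPow p α N) := by
  rw [monomialNormPow, ← lintegral_radial_eq_beta (by positivity) hα]
  refine lintegral_congr fun z => ?_
  rw [norm_pow, ← Real.rpow_natCast_mul (norm_nonneg z)]

theorem norm_le_bergmanNorm {p α : ℝ} (hp : 0 < p) (hα : -1 < α) (N : ℕ) {a : ℂ}
    (ha : a ∈ unitDisk) {g : ℂ → ℂ} (hg : AnalyticOnNhd ℂ g unitDisk)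
    (hint : Integrable (fun z => ‖(z - a) ^ N * g z‖ ^ p * standardWeight α z) diskArea) :
    (1 - ‖a‖ ^ 2) ^ ((N : ℝ) + (2 + α) / p) * ‖g a‖ * monomialNormPow p α N ^ (1 / p) ≤
      bergmanNorm p α fun z => (z - a) ^ N * g z := by
  have hc := one_sub_norm_sq_pos ha
  have hB := monomialNormPow_pos hp hα N
  have h0 : (0 : ℂ) ∈ unitDisk := mem_unitDisk.2 (by simp)
  -- On the disk, `z ^ N * H z` is the isometric image of `(z - a) ^ N * g z`; the power of `z` is
  -- removed without dividing by it.
  set H : ℂ → ℂ := fun z => (-(1 - conj a * a) / (1 - conj a * z)) ^ N *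
    g (diskInvolution a z) * isometryFactor p α a z with hHdef
  have hH : AnalyticOnNhd ℂ H unitDisk := fun z hz => by
    have h1 := analyticAt_div_one_sub_conj_mul_pow (-(1 - conj a * a)) N ha hz
    have h2 : AnalyticAt ℂ (fun z => g (diskInvolution a z)) z :=
      (hg _ (diskInvolution_mem ha hz)).fun_comp (analyticAt_diskInvolution ha hz)
    exact (h1.fun_mul h2).fun_mul (analyticAt_isometryFactor p α ha hz)
  have hH0 : ‖H 0‖ = (1 - ‖a‖ ^ 2) ^ ((N : ℝ) + (2 + α) / p) * ‖g a‖ := by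
    have h1 : diskInvolution a 0 = a := by simp [diskInvolution]
    simp only [hHdef, h1, isometryFactor, ← ofReal_one_sub_norm_sq]
    rw [mul_zero, sub_zero, Complex.one_cpow, mul_one, div_one, norm_mul, norm_mul, norm_pow,
      norm_neg, Complex.norm_real, Complex.norm_real, Real.norm_eq_abs, Real.norm_eq_abs,
      abs_of_pos hc, abs_of_pos (Real.rpow_pos_of_pos hc _), Real.rpow_add hc, Real.rpow_natCast]
    ring
  have hle := monomialNormPow_mul_le hp hα N hH
  have heq : ∫⁻ z, ENNReal.ofReal (‖z ^ N * H z‖ ^ p * standardWeight α z) ∂diskArea =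
      ∫⁻ z, ENNReal.ofReal (‖(z - a) ^ N * g z‖ ^ p * standardWeight α z) ∂diskArea := by
    rw [← lintegral_isometry hp α ha fun z => (z - a) ^ N * g z]
    refine lintegral_congr_ae ?_
    filter_upwards [ae_mem_unitDisk] with z hz
    simp only [hHdef, diskInvolution_sub ha hz, mul_pow, mul_assoc]
  rw [heq, ← ofReal_integral_eq_lintegral_ofReal hint (ae_integrand_nonneg hα p _),
    ENNReal.ofReal_le_ofReal_iff (integral_nonneg_of_ae (ae_integrand_nonneg hα p _))] at hle
  have := Real.rpow_le_rpow (by positivity) hle (by positivity : 0 ≤ 1 / p)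
  rwa [Real.mul_rpow (by positivity) hB.le, ← Real.rpow_mul (norm_nonneg _),
    mul_one_div_cancel hp.ne', Real.rpow_one, hH0] at this

/-! ### The extremal function -/

/-- The extremal function of the point evaluation of the `N`-th derivative at `a`. -/
noncomputable def bergmanExtremal (p α : ℝ) (N : ℕ) (a z : ℂ) : ℂ :=
  (z - a) ^ N * (((monomialNormPow p α N ^ (-(1 / p)) : ℝ) : ℂ) *
    ((-1 / (1 - conj a * z)) ^ N * isometryFactor p α a z))

theorem analyticAt_bergmanExtremal_cofactor (p α : ℝ) (N : ℕ) {a z : ℂ} (ha : a ∈ unitDisk)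
    (hz : z ∈ unitDisk) :
    AnalyticAt ℂ (fun z => ((monomialNormPow p α N ^ (-(1 / p)) : ℝ) : ℂ) *
      ((-1 / (1 - conj a * z)) ^ N * isometryFactor p α a z)) z :=
  analyticAt_const.fun_mul ((analyticAt_div_one_sub_conj_mul_pow (-1) N ha hz).fun_mul
    (analyticAt_isometryFactor p α ha hz))

theorem analyticOnNhd_bergmanExtremal (p α : ℝ) (N : ℕ) {a : ℂ} (ha : a ∈ unitDisk) :
    AnalyticOnNhd ℂ (bergmanExtremal p α N a) unitDisk := fun z hz =>
  AnalyticAt.mul (f := fun z => (z - a) ^ N) (by fun_prop)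
    (analyticAt_bergmanExtremal_cofactor p α N ha hz)

theorem lintegral_bergmanExtremal {p α : ℝ} (hp : 0 < p) (hα : -1 < α) (N : ℕ) {a : ℂ}
    (ha : a ∈ unitDisk) :
    ∫⁻ z, ENNReal.ofReal (‖bergmanExtremal p α N a z‖ ^ p * standardWeight α z) ∂diskArea = 1 := by
  have hB := monomialNormPow_pos hp hα N
  have h : ∫⁻ z, ENNReal.ofReal
      (‖bergmanExtremal p α N a z‖ ^ p * standardWeight α z) ∂diskArea =
      ∫⁻ z, ENNReal.ofReal (monomialNormPow p α N)⁻¹ * ENNReal.ofReal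
        (‖diskInvolution a z ^ N * isometryFactor p α a z‖ ^ p * standardWeight α z)
        ∂diskArea := by
    refine lintegral_congr_ae ?_
    filter_upwards [ae_mem_unitDisk] with z hz
    -- Up to normalization, the extremal function is the isometric image of the monomial `z ^ N`.
    have h1 : bergmanExtremal p α N a z = ((monomialNormPow p α N ^ (-(1 / p)) : ℝ) : ℂ) *
        (diskInvolution a z ^ N * isometryFactor p α a z) := by
      rw [bergmanExtremal, show diskInvolution a z = (z - a) * (-1 / (1 - conj a * z)) by
        rw [diskInvolution]; ring, mul_pow]
      ring
    rw [h1, norm_mul, Complex.norm_real, Real.norm_eq_abs, abs_of_pos (by positivity),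
      Real.mul_rpow (by positivity) (by positivity), ← Real.rpow_mul hB.le,
      ← ENNReal.ofReal_mul (by positivity), mul_assoc, neg_mul, one_div_mul_cancel hp.ne',
      Real.rpow_neg_one]
  rw [h, lintegral_const_mul' _ _ ENNReal.ofReal_ne_top,
    lintegral_isometry hp α ha fun z => z ^ N, lintegral_monomial hp hα,
    ← ENNReal.ofReal_mul (by positivity), inv_mul_cancel₀ hB.ne', ENNReal.ofReal_one]

theorem bergmanExtremal_mem {p α : ℝ} (hp : 0 < p) (hα : -1 < α) (N : ℕ) {a : ℂ}
    (ha : a ∈ unitDisk) : bergmanExtremal p α N a ∈ BergmanVanishing p α N a := by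
  have han := analyticOnNhd_bergmanExtremal p α N ha
  refine ⟨⟨han, aestronglyMeasurable_integrand hp α han.continuousOn, ?_⟩,
    (iteratedDeriv_sub_pow_mul (analyticAt_bergmanExtremal_cofactor p α N ha ha) N).1⟩
  rw [hasFiniteIntegral_iff_ofReal (ae_integrand_nonneg hα p _),
    lintegral_bergmanExtremal hp hα N ha]
  exact ENNReal.one_lt_top

theorem bergmanNorm_bergmanExtremal {p α : ℝ} (hp : 0 < p) (hα : -1 < α) (N : ℕ) {a : ℂ}
    (ha : a ∈ unitDisk) : bergmanNorm p α (bergmanExtremal p α N a) = 1 := by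
  rw [bergmanNorm, integral_eq_lintegral_of_nonneg_ae (ae_integrand_nonneg hα p _)
    (bergmanExtremal_mem hp hα N ha).1.2.aestronglyMeasurable,
    lintegral_bergmanExtremal hp hα N ha, ENNReal.toReal_one, Real.one_rpow]

theorem norm_iteratedDeriv_bergmanExtremal {p α : ℝ} (hp : 0 < p) (hα : -1 < α) (N : ℕ) {a : ℂ}
    (ha : a ∈ unitDisk) :
    ‖iteratedDeriv N (bergmanExtremal p α N a) a‖ = N.factorial *
      monomialNormPow p α N ^ (-(1 / p)) / (1 - ‖a‖ ^ 2) ^ ((N : ℝ) + (2 + α) / p) := by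
  have hB := monomialNormPow_pos hp hα N
  have hc := one_sub_norm_sq_pos ha
  have h := (iteratedDeriv_sub_pow_mul (analyticAt_bergmanExtremal_cofactor p α N ha ha) N).2
  change iteratedDeriv N (bergmanExtremal p α N a) a = _ at h
  rw [h, isometryFactor, ← ofReal_one_sub_norm_sq]
  simp only [norm_mul, norm_pow, norm_div, norm_neg, norm_one, Complex.norm_cpow_real,
    Complex.norm_real, Complex.norm_natCast, Real.norm_eq_abs, abs_of_pos hc]
  rw [abs_of_pos (by positivity), abs_of_pos (by positivity), ← Real.rpow_add hc,
    Real.rpow_add hc (N : ℝ), Real.rpow_natCast,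
    show (2 + α) / p + -(2 * ((2 + α) / p)) = -((2 + α) / p) by ring, Real.rpow_neg hc.le,
    one_div_pow]
  field_simp

theorem mainTheorem3 (p α : ℝ) (hp : 0 < p) (hα : -1 < α) (N : ℕ) (hN : 1 ≤ N)
    (a : ℂ) (ha : a ∈ unitDisk) :
    (∀ f ∈ BergmanVanishing p α N a,
      ‖iteratedDeriv N f a‖ ≤
        (N.factorial : ℝ) *
          (Real.Gamma (N * p / 2 + 2 + α) /
            (Real.Gamma (2 + α) * Real.Gamma (N * p / 2 + 1))) ^ (1 / p) *
          (bergmanNorm p α f / (1 - ‖a‖ ^ 2) ^ ((N : ℝ) + (2 + α) / p))) ∧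
    (∃ f ∈ BergmanVanishing p α N a, bergmanNorm p α f = 1 ∧
      ‖iteratedDeriv N f a‖ =
        (N.factorial : ℝ) *
          (Real.Gamma (N * p / 2 + 2 + α) /
            (Real.Gamma (2 + α) * Real.Gamma (N * p / 2 + 1))) ^ (1 / p) *
          (bergmanNorm p α f / (1 - ‖a‖ ^ 2) ^ ((N : ℝ) + (2 + α) / p))) := by
  have hB := monomialNormPow_pos hp hα N
  have hc := one_sub_norm_sq_pos ha
  have hconst : (Real.Gamma (N * p / 2 + 2 + α) /
      (Real.Gamma (2 + α) * Real.Gamma (N * p / 2 + 1))) ^ (1 / p) =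
      monomialNormPow p α N ^ (-(1 / p)) := by
    rw [Real.rpow_neg hB.le, ← Real.inv_rpow hB.le, monomialNormPow, inv_div]
  rw [hconst]
  refine ⟨fun f hf => ?_, bergmanExtremal p α N a, bergmanExtremal_mem hp hα N ha,
    bergmanNorm_bergmanExtremal hp hα N ha, ?_⟩
  -- The `N`-th derivative at `a` is `N! * g a`, so the bound on `‖g a‖` suffices.
  · obtain ⟨g, hg, rfl⟩ := exists_eq_sub_pow_mul hf.1.1 ha hf.2
    have h := norm_le_bergmanNorm hp hα N ha hg hf.1.2
    rw [(iteratedDeriv_sub_pow_mul (hg a ha) N).2, norm_mul, Complex.norm_natCast, mul_assoc]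
    gcongr
    rw [Real.rpow_neg hB.le, ← mul_div_assoc, le_div_iff₀ (by positivity), inv_mul_eq_div,
      le_div_iff₀ (by positivity)]
    linarith
  · rw [norm_iteratedDeriv_bergmanExtremal hp hα N ha, bergmanNorm_bergmanExtremal hp hα N ha]
    ring
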